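/- For a permutation $\pi=(\pi(1),\dots,\pi(n))$ of $[n]=\{1,\dots,n\}$, a pair of twins of length $k$ in $\pi$ consists of two subsequences $(\pi(s_1),\dots,\pi(s_k))$ and $(\pi(t_1),\dots,\pi(t_k))$, with $s_1<\dots<s_k$ and $t_1<\dots<t_k$, such that $\{s_1,\dots,s_k\}\cap\{t_1,\dots,t_k\}=\emptyset$ and the two subsequences have the same relative order, that is, $\pi(s_i)<\pi(s_j)$ if and only if $\pi(t_i)<\pi(t_j)$ for all $1\le i<j\le k$. Let $t(\pi)$ be the largest integer $k$ such that $\pi$ contains a pair of twins of length $k$. **Theorem.** Let $\Pi_n$ be chosen uniformly at random from all $n!$ permutations of $[n]$. There exist absolute constants $c,C>0$ such that $$\lim_{n\to\infty}\mathbb P\left(c\,\frac{n^{2/3}}{(\log n)^{1/3}}\le t(\Pi_n)\le C\,n^{2/3}\right)=1 .$$ -/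

import Mathlib

open Filter Topology MeasureTheory

/-- Two sequences `(x₁, …, x_k)` and `(y₁, …, y_k)` are similar if they have the same relative
order: `x_i < x_j` if and only if `y_i < y_j`, for all `i < j`. -/
def OrderSimilar {k n : ℕ} (x y : Fin k → Fin n) : Prop :=
  ∀ i j : Fin k, i < j → (x i < x j ↔ y i < y j)

/-- The permutation `π`, read as the sequence `(π 0, …, π (n - 1))`, contains a pair of twins of
length `k`: two similar subsequences, on disjoint sets of positions given by the increasing
enumerations `s` and `t`. -/
def HasTwins {n : ℕ} (π : Equiv.Perm (Fin n)) (k : ℕ) : Prop :=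
  ∃ s t : Fin k ↪o Fin n,
    Disjoint (Set.range s) (Set.range t) ∧ OrderSimilar (fun i => π (s i)) (fun i => π (t i))

/-- `twinLength π` is the largest `k` such that `π` contains a pair of twins of length `k`
(see `isGreatest_twinLength`). -/
noncomputable def twinLength {n : ℕ} (π : Equiv.Perm (Fin n)) : ℕ :=
  sSup {k : ℕ | HasTwins π k}

/-- The supremum defining `twinLength` is an attained maximum. -/
theorem isGreatest_twinLength {n : ℕ} (π : Equiv.Perm (Fin n)) :
    IsGreatest {k : ℕ | HasTwins π k} (twinLength π) := by
  have hne : {k : ℕ | HasTwins π k}.Nonempty := by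
    let e : Fin 0 ↪o Fin n := Fin.castLEOrderEmb (Nat.zero_le n)
    exact ⟨0, e, e, by simp, fun i => i.elim0⟩
  have hbdd : BddAbove {k : ℕ | HasTwins π k} := by
    refine ⟨n, ?_⟩
    rintro k ⟨s, -⟩
    simpa using Fintype.card_le_of_injective s s.injective
  exact ⟨Nat.sSup_mem hne hbdd, fun k hk => le_csSup hbdd hk⟩

/-- The law of the random permutation `Π_n`: the uniform distribution on all `n!` permutations of
an `n`-element set, every set of permutations being an event. -/
noncomputable def randomPermLaw (n : ℕ) : @Measure (Equiv.Perm (Fin n)) ⊤ :=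
  @PMF.toMeasure (Equiv.Perm (Fin n)) ⊤ (PMF.uniformOfFintype (Equiv.Perm (Fin n)))

/-!
Both bounds hold with probability tending to `1`, the lower one even without the logarithm.

*Upper bound.* For fixed disjoint position sets of size `k`, a random permutation has similar
subsequences there with probability at most `1 / k!`: permuting the entries on the second set in
all `k!` ways gives distinct permutations, as the original one can be recovered
(`eq_of_mul_viaFintypeEmbedding_eq`). So the expected number of twins of length `k` is at most
`(n.choose k) ^ 2 / k! ≤ (e ^ 3 * n ^ 2 / k ^ 3) ^ k`, which is at most `2 ^ (-k)` for
`k ≥ 4 * n ^ (2 / 3)` (`card_hasTwins_div_factorial_le`).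

*Lower bound.* Let `r` be about `n ^ (2 / 3) / 32`. Divide the positions into `4 * r` rows and the
values into `4 * r` columns, all of them intervals. A family of `r` cells, no two in the same row
or column and each with two points of the permutation, yields twins of length `r`. If there is no
such family, then a maximal one leaves sets `I` of rows and `J` of columns, of size at least
`3 * r` each, such that no cell of `I × J` contains two points (`isSparseTable_of_not_hasTwins`).
For fixed `I` and `J` this has probability at most `16 ^ (-3 * r)`, since a row has length of order
`n ^ (1 / 3)`, and so has a pair of points in one column of `J` with probability at least `15 / 16`
(`sixteen_mul_card_injOn_le`). The union bound over the at most `16 ^ (2 * r)` pairs `(I, J)` gives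
`16 ^ (-r)` (`pow_mul_card_isSparseTable_le`).

To make the entries independent, the permutation is replaced by a uniform word of length `n` over
an alphabet of at least `2 * n ^ 2` letters, namely pairs of a column and a position in it, ordered
lexicographically. Such a word is injective with probability at least `1 / 2`, and its relative
order is then a uniform permutation; hence probabilities at most double
(`card_perm_mul_choose_le`, `pow_le_two_mul_factorial_mul_choose`).
-/

/-! ### The number of permutations with long twins -/

/-- An injective sequence of a linear order is determined by its relative order and its range. -/
theorem eq_of_forall_lt_iff_of_range_eq {k : ℕ} {α : Type*} [LinearOrder α] {u v : Fin k → α}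
    (hu : Function.Injective u) (hlt : ∀ i j, u i < u j ↔ v i < v j)
    (hr : Set.range u = Set.range v) : u = v := by
  have h1 : StrictMono (u ∘ Tuple.sort u) :=
    (Tuple.monotone_sort u).strictMono_of_injective (hu.comp (Tuple.sort u).injective)
  have h2 : StrictMono (v ∘ Tuple.sort u) := fun i j hij => (hlt _ _).1 (h1 hij)
  have h3 : u ∘ Tuple.sort u = v ∘ Tuple.sort u := by
    rw [← h1.range_inj h2, (Tuple.sort u).surjective.range_comp,
      (Tuple.sort u).surjective.range_comp, hr]
  exact (Tuple.sort u).surjective.injective_comp_right h3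

theorem OrderSimilar.lt_iff_lt {k n : ℕ} {x y : Fin k → Fin n} (h : OrderSimilar x y)
    (hx : Function.Injective x) (hy : Function.Injective y) (i j : Fin k) :
    x i < x j ↔ y i < y j := by
  rcases lt_trichotomy i j with hij | rfl | hij
  · exact h i j hij
  · simp
  · have h1 := h j i hij
    have h2 : x i ≠ x j := fun e => hij.ne' (hx e)
    have h3 : y i ≠ y j := fun e => hij.ne' (hy e)
    rw [← not_le, ← not_le, le_iff_lt_or_eq, le_iff_lt_or_eq, h1]
    simp [h2.symm, h3.symm]

/-- If `π` has twins at `s` and `t`, then after permuting the entries of `π` at `t` by `σ`, both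
`π` and `σ` can be recovered: the entries at `s` are unchanged and prescribe the original order of
those at `t`. -/
theorem eq_of_mul_viaFintypeEmbedding_eq {k n : ℕ} {s t : Fin k ↪o Fin n}
    (hd : Disjoint (Set.range s) (Set.range t)) {π π' : Equiv.Perm (Fin n)}
    {σ σ' : Equiv.Perm (Fin k)}
    (h : OrderSimilar (fun i => π (s i)) (fun i => π (t i)))
    (h' : OrderSimilar (fun i => π' (s i)) (fun i => π' (t i)))
    (e : π * σ.viaFintypeEmbedding t.toEmbedding = π' * σ'.viaFintypeEmbedding t.toEmbedding) :
    π = π' ∧ σ = σ' := by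
  have hout : ∀ x ∉ Set.range t, π x = π' x := fun x hx => by
    have := DFunLike.congr_fun e x
    rwa [Equiv.Perm.mul_apply, Equiv.Perm.mul_apply,
      Equiv.Perm.viaFintypeEmbedding_apply_notMem_range _ _ (by simpa using hx),
      Equiv.Perm.viaFintypeEmbedding_apply_notMem_range _ _ (by simpa using hx)] at this
  have hin : ∀ i, π (t (σ i)) = π' (t (σ' i)) := fun i => by
    have := DFunLike.congr_fun e (t i)
    have h1 := Equiv.Perm.viaFintypeEmbedding_apply_image σ t.toEmbedding i
    have h2 := Equiv.Perm.viaFintypeEmbedding_apply_image σ' t.toEmbedding i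
    simp only [RelEmbedding.coe_toEmbedding] at h1 h2
    rwa [Equiv.Perm.mul_apply, Equiv.Perm.mul_apply, h1, h2] at this
  have hs : ∀ i, π (s i) = π' (s i) := fun i =>
    hout _ (Set.disjoint_left.1 hd (Set.mem_range_self i))
  have hinj : ∀ (ρ : Equiv.Perm (Fin n)) (f : Fin k ↪o Fin n),
      Function.Injective fun i => ρ (f i) := fun ρ f => ρ.injective.comp f.injective
  have ht : (fun i => π (t i)) = fun i => π' (t i) := by
    refine eq_of_forall_lt_iff_of_range_eq (hinj π t) (fun i j => ?_) ?_
    · rw [← h.lt_iff_lt (hinj π s) (hinj π t), ← h'.lt_iff_lt (hinj π' s) (hinj π' t)]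
      simp only [hs]
    · rw [← σ.surjective.range_comp, ← σ'.surjective.range_comp fun i => π' (t i)]
      exact congrArg Set.range (funext hin)
  have hπ : π = π' := Equiv.ext fun x => by
    by_cases hx : x ∈ Set.range t
    · obtain ⟨i, rfl⟩ := hx
      exact congrFun ht i
    · exact hout x hx
  refine ⟨hπ, Equiv.ext fun i => ?_⟩
  have := hin i
  rw [hπ] at this
  exact t.injective (π'.injective this)

theorem card_orderEmb_le_choose (k n : ℕ) : Nat.card (Fin k ↪o Fin n) ≤ n.choose k := by
  have hc : Nat.card (Finset.powersetCard k (Finset.univ : Finset (Fin n))) = n.choose k := by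
    rw [Nat.card_eq_fintype_card, Fintype.card_coe, Finset.card_powersetCard, Finset.card_univ,
      Fintype.card_fin]
  rw [← hc]
  refine Nat.card_le_card_of_injective
    (fun s => ⟨Finset.univ.map s.toEmbedding, by simp [Finset.mem_powersetCard]⟩) ?_
  intro s t e
  have e' := congrArg (fun S : Finset (Fin n) => (S : Set (Fin n))) (Subtype.ext_iff.1 e)
  simp only [Finset.coe_map, Finset.coe_univ, Set.image_univ, RelEmbedding.coe_toEmbedding] at e'
  exact DFunLike.coe_injective ((s.strictMono.range_inj t.strictMono).1 e')

/-- The first moment bound: each of the `(n.choose k) ^ 2` pairs of position sets carries twins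
with probability at most `1 / k!`. -/
theorem card_hasTwins_mul_factorial_le (n k : ℕ) :
    Nat.card {π : Equiv.Perm (Fin n) // HasTwins π k} * k.factorial
      ≤ n.choose k ^ 2 * n.factorial := by
  choose s t hd hsim using fun π : {π : Equiv.Perm (Fin n) // HasTwins π k} => π.2
  have hcard := Nat.card_le_card_of_injective
    (fun p : {π : Equiv.Perm (Fin n) // HasTwins π k} × Equiv.Perm (Fin k) =>
      (((s p.1, t p.1), p.1.1 * p.2.viaFintypeEmbedding (t p.1).toEmbedding) :
        ((Fin k ↪o Fin n) × (Fin k ↪o Fin n)) × Equiv.Perm (Fin n))) (by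
      rintro ⟨π, σ⟩ ⟨π', σ'⟩ e
      simp only [Prod.mk.injEq] at e
      obtain ⟨⟨es, et⟩, e⟩ := e
      have h' := hsim π'
      rw [← es, ← et] at h'
      rw [← et] at e
      obtain ⟨h1, h2⟩ := eq_of_mul_viaFintypeEmbedding_eq (hd π) (hsim π) h' e
      exact Prod.ext (Subtype.ext h1) h2)
  simp only [Nat.card_prod, Nat.card_perm, Nat.card_fin] at hcard
  refine hcard.trans (Nat.mul_le_mul_right _ ?_)
  rw [sq]
  exact Nat.mul_le_mul (card_orderEmb_le_choose k n) (card_orderEmb_le_choose k n)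

theorem HasTwins.mono {n k l : ℕ} {π : Equiv.Perm (Fin n)} (h : HasTwins π l) (hkl : k ≤ l) :
    HasTwins π k := by
  obtain ⟨s, t, hd, hs⟩ := h
  refine ⟨(Fin.castLEOrderEmb hkl).trans s, (Fin.castLEOrderEmb hkl).trans t,
    hd.mono ?_ ?_, fun i j hij => hs _ _ ((Fin.castLEOrderEmb hkl).strictMono hij)⟩
  · rintro _ ⟨i, rfl⟩; exact ⟨_, rfl⟩
  · rintro _ ⟨i, rfl⟩; exact ⟨_, rfl⟩

theorem le_twinLength_iff {n k : ℕ} {π : Equiv.Perm (Fin n)} :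
    k ≤ twinLength π ↔ HasTwins π k :=
  ⟨fun h => (isGreatest_twinLength π).1.mono h, fun h => (isGreatest_twinLength π).2 h⟩

theorem card_hasTwins_div_factorial_le {n k : ℕ} (h : (4 : ℝ) ^ 3 * (n : ℝ) ^ 2 ≤ (k : ℝ) ^ 3) :
    (Nat.card {π : Equiv.Perm (Fin n) // HasTwins π k} : ℝ) / n.factorial ≤ (1 / 2) ^ k := by
  rcases Nat.eq_zero_or_pos k with rfl | hk
  · rw [pow_zero, div_le_one (by positivity)]
    have := card_hasTwins_mul_factorial_le n 0
    simp only [Nat.factorial_zero, mul_one, Nat.choose_zero_right, one_pow, one_mul] at this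
    exact_mod_cast this
  have hk0 : (0 : ℝ) < k := by exact_mod_cast hk
  have hkf : (0 : ℝ) < k.factorial := by positivity
  have h1 : (Nat.card {π : Equiv.Perm (Fin n) // HasTwins π k} : ℝ) * k.factorial
      ≤ (n.choose k : ℝ) ^ 2 * n.factorial := by
    exact_mod_cast card_hasTwins_mul_factorial_le n k
  have h2 : (n.choose k : ℝ) ≤ (n : ℝ) ^ k / k.factorial := Nat.choose_le_pow_div k n
  have h3 : (k : ℝ) ^ k / k.factorial ≤ Real.exp 1 ^ k := by
    have := Real.pow_div_factorial_le_exp (k : ℝ) hk0.le k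
    rwa [← Real.exp_one_rpow, Real.rpow_natCast] at this
  have h4 : Real.exp 1 ^ 3 ≤ 32 := by
    calc Real.exp 1 ^ 3 ≤ (3 : ℝ) ^ 3 := by gcongr; exact Real.exp_one_lt_three.le
      _ ≤ 32 := by norm_num
  rw [div_le_iff₀ (by positivity)]
  have h5 : ((n : ℝ) ^ k) ^ 2 / (k.factorial : ℝ) ^ 3 ≤ (1 / 2) ^ k := by
    have h6 : ((n : ℝ) ^ k) ^ 2 * (4 ^ 3) ^ k ≤ ((k : ℝ) ^ k) ^ 3 := by
      rw [← pow_mul, ← pow_mul (k : ℝ), mul_comm k 2, mul_comm k 3, pow_mul, pow_mul, ← mul_pow,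
        mul_comm]
      gcongr
    have h7 : ((k : ℝ) ^ k / k.factorial) ^ 3 ≤ 32 ^ k := by
      calc ((k : ℝ) ^ k / k.factorial) ^ 3 ≤ (Real.exp 1 ^ k) ^ 3 := by gcongr
        _ = (Real.exp 1 ^ 3) ^ k := by rw [← pow_mul, ← pow_mul, mul_comm]
        _ ≤ 32 ^ k := by gcongr
    rw [div_pow, div_le_iff₀ (by positivity)] at h7
    rw [div_le_iff₀ (by positivity)]
    have h8 : ((n : ℝ) ^ k) ^ 2 * (4 ^ 3) ^ k
        ≤ ((1 / 2) ^ k * (k.factorial : ℝ) ^ 3) * (4 ^ 3) ^ k := by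
      calc _ ≤ _ := h6.trans h7
        _ = _ := by
          rw [mul_right_comm, ← mul_pow]; norm_num
    exact le_of_mul_le_mul_right h8 (by positivity)
  calc (Nat.card {π : Equiv.Perm (Fin n) // HasTwins π k} : ℝ)
      ≤ (n.choose k : ℝ) ^ 2 * n.factorial / k.factorial := by rwa [le_div_iff₀ hkf]
    _ ≤ ((n : ℝ) ^ k / k.factorial) ^ 2 * n.factorial / k.factorial := by gcongr
    _ = ((n : ℝ) ^ k) ^ 2 / (k.factorial : ℝ) ^ 3 * n.factorial := by field_simp
    _ ≤ _ := by gcongr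

/-! ### Words without collisions -/

theorem Real.exp_neg_le_one_sub_half {x : ℝ} (h0 : 0 ≤ x) (h1 : x ≤ 1) :
    Real.exp (-x) ≤ 1 - x / 2 := by
  have h2 : 1 + x ≤ Real.exp x := by linarith [Real.add_one_le_exp x]
  rw [Real.exp_neg, inv_le_iff_one_le_mul₀ (Real.exp_pos x)]
  nlinarith

theorem card_forall_notMem {m : ℕ} (b : ℕ) (S : Finset (Fin m)) :
    Nat.card {h : Fin b → Fin m // ∀ p, h p ∉ S} = (m - S.card) ^ b := by
  rw [Nat.card_congr (Equiv.subtypePiEquivPi (p := fun _ c => c ∉ S)), Nat.card_fun,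
    Nat.card_fin, Nat.card_eq_fintype_card, Fintype.card_subtype_compl]
  simp

/-- Words of length `2 * b` are split in two halves. If the first half takes `q` distinct values in
`J`, then the second half has to avoid these, which happens with probability at most
`exp (-b / m) ^ q`. -/
theorem card_injOn_le_sum {m b : ℕ} (hm : 0 < m) (J : Finset (Fin m)) :
    (Nat.card {h : Fin b ⊕ Fin b → Fin m // Set.InjOn h (h ⁻¹' J)} : ℝ)
      ≤ (m : ℝ) ^ b *
        ∑ h : Fin b → Fin m, ∏ p, if h p ∈ J then Real.exp (-((b : ℝ) / m)) else 1 := by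
  classical
  let V : (Fin b → Fin m) → Finset (Fin m) := fun h => (Finset.univ.filter (h · ∈ J)).image h
  have hcard := Nat.card_le_card_of_injective
    (β := Σ h₁ : {h : Fin b → Fin m // Set.InjOn h (h ⁻¹' J)},
      {h : Fin b → Fin m // ∀ p, h p ∉ V h₁.1})
    (fun h : {h : Fin b ⊕ Fin b → Fin m // Set.InjOn h (h ⁻¹' J)} =>
      ⟨⟨h.1 ∘ Sum.inl, fun p hp q hq e => Sum.inl_injective (h.2 hp hq e)⟩,
        ⟨h.1 ∘ Sum.inr, fun p hp => by
          obtain ⟨q, hq, e⟩ := Finset.mem_image.1 hp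
          have hq' : h.1 (Sum.inl q) ∈ J := (Finset.mem_filter.1 hq).2
          have e' : h.1 (Sum.inl q) = h.1 (Sum.inr p) := e
          exact Sum.inl_ne_inr (h.2 hq' (by rw [e'] at hq'; exact hq') e')⟩⟩) (by
      rintro ⟨h, hh⟩ ⟨h', hh'⟩ e
      have e1 : h ∘ Sum.inl = h' ∘ Sum.inl := congrArg (fun x => x.1.1) e
      have e2 : h ∘ Sum.inr = h' ∘ Sum.inr := congrArg (fun x => x.2.1) e
      refine Subtype.ext (funext ?_)
      rintro (p | p)
      · exact congrFun e1 p
      · exact congrFun e2 p)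
  rw [Nat.card_sigma] at hcard
  simp only [card_forall_notMem] at hcard
  have hm0 : (0 : ℝ) < m := by exact_mod_cast hm
  have hterm : ∀ h : {h : Fin b → Fin m // Set.InjOn h (h ⁻¹' J)},
      (((m - (V h.1).card) ^ b : ℕ) : ℝ)
        ≤ (m : ℝ) ^ b * ∏ p, if h.1 p ∈ J then Real.exp (-((b : ℝ) / m)) else 1 := by
    rintro ⟨h, hh⟩
    have hV : (V h).card = (Finset.univ.filter (h · ∈ J)).card :=
      Finset.card_image_of_injOn fun p hp q hq e => hh (by simpa using hp) (by simpa using hq) e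
    have hVm : (V h).card ≤ m := by simpa using Finset.card_le_univ (V h)
    rw [Finset.prod_ite, Finset.prod_const, Finset.prod_const_one, mul_one, ← hV,
      ← Real.exp_nat_mul]
    push_cast [Nat.cast_sub hVm]
    calc ((m : ℝ) - (V h).card) ^ b
        = (m : ℝ) ^ b * (1 - (V h).card / m) ^ b := by
          rw [← mul_pow]; congr 1; field_simp
      _ ≤ (m : ℝ) ^ b * Real.exp (-((V h).card / m)) ^ b := by
          gcongr
          · rw [sub_nonneg, div_le_one hm0]; exact_mod_cast hVm
          · exact Real.one_sub_le_exp_neg _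
      _ = _ := by rw [← Real.exp_nat_mul]; congr 2; ring
  calc (Nat.card {h : Fin b ⊕ Fin b → Fin m // Set.InjOn h (h ⁻¹' J)} : ℝ)
      ≤ ∑ h : {h : Fin b → Fin m // Set.InjOn h (h ⁻¹' J)},
          (((m - (V h.1).card) ^ b : ℕ) : ℝ) := by exact_mod_cast hcard
    _ ≤ ∑ h : {h : Fin b → Fin m // Set.InjOn h (h ⁻¹' J)},
          (m : ℝ) ^ b * ∏ p, if h.1 p ∈ J then Real.exp (-((b : ℝ) / m)) else 1 :=
        Finset.sum_le_sum fun h _ => hterm h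
    _ ≤ _ := by
        rw [← Finset.mul_sum]
        gcongr
        rw [← Finset.sum_subtype (Finset.univ.filter fun h : Fin b → Fin m =>
          Set.InjOn h (h ⁻¹' J)) (by simp)
          fun h => ∏ p, if h p ∈ J then Real.exp (-((b : ℝ) / m)) else 1]
        exact Finset.sum_le_sum_of_subset_of_nonneg (Finset.subset_univ _) fun h _ _ =>
          Finset.prod_nonneg fun p _ => by split_ifs <;> positivity

/-- If the words are long enough for the expected number of coinciding pairs of letters in `J` to
be a large constant, then a random word has no such pair with probability at most `1 / 16`. -/
theorem sixteen_mul_card_injOn_le {m b : ℕ} {J : Finset (Fin m)} (hm : 0 < m) (hbm : b ≤ m)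
    (hJ : 3 * m ≤ 4 * J.card) (hb : 8 * m ≤ b ^ 2) :
    16 * Nat.card {h : Fin b ⊕ Fin b → Fin m // Set.InjOn h (h ⁻¹' J)} ≤ m ^ (2 * b) := by
  have hm0 : (0 : ℝ) < m := by exact_mod_cast hm
  have hbm' : (b : ℝ) ≤ m := by exact_mod_cast hbm
  have hJ' : 3 * (m : ℝ) ≤ 4 * J.card := by exact_mod_cast hJ
  have hb' : 8 * (m : ℝ) ≤ (b : ℝ) ^ 2 := by exact_mod_cast hb
  have hlam := Real.exp_neg_le_one_sub_half (x := (b : ℝ) / m) (by positivity)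
    ((div_le_one hm0).2 hbm')
  set lam := Real.exp (-((b : ℝ) / m))
  have hx0 : 0 ≤ (b : ℝ) / m := by positivity
  have hsum : ∑ c : Fin m, (if c ∈ J then lam else 1) ≤ m * Real.exp (-(3 / 8 * (b / m))) := by
    have e : ∑ c : Fin m, (if c ∈ J then lam else 1) = m - J.card * (1 - lam) := by
      have h1 : ∀ c : Fin m, (if c ∈ J then lam else 1) = 1 - if c ∈ J then 1 - lam else 0 := by
        intro c; split_ifs <;> ring
      simp [h1, Finset.sum_sub_distrib, mul_sub]
    have h2 := Real.one_sub_le_exp_neg (3 / 8 * ((b : ℝ) / m))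
    calc _ = m - J.card * (1 - lam) := e
      _ ≤ m - (3 / 4 * m) * (1 / 2 * (b / m)) := by
          gcongr
          · linarith
          · linarith
      _ = m * (1 - 3 / 8 * (b / m)) := by ring
      _ ≤ _ := by gcongr
  have hs0 : 0 ≤ ∑ c : Fin m, (if c ∈ J then lam else 1) :=
    Finset.sum_nonneg fun c _ => by split_ifs <;> positivity
  have hexp : 16 * Real.exp (-(3 / 8 * (b / m))) ^ b ≤ 1 := by
    have h3 : (8 : ℝ) ≤ b * (b / m) := by
      rw [mul_div_assoc', le_div_iff₀ hm0]; linarith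
    have h4 : Real.exp (-(3 / 8 * (b / m))) ^ b ≤ Real.exp (-3) := by
      rw [← Real.exp_nat_mul, Real.exp_le_exp]
      linarith
    have h5 : (16 : ℝ) ≤ Real.exp 3 := by
      have h6 : Real.exp 3 = Real.exp 1 ^ 3 := by rw [← Real.exp_nat_mul]; norm_num
      rw [h6]
      calc (16 : ℝ) ≤ 2.7 ^ 3 := by norm_num
        _ ≤ Real.exp 1 ^ 3 := by
          gcongr
          linarith [Real.exp_one_gt_d9]
    calc _ ≤ 16 * Real.exp (-3) := by gcongr
      _ ≤ 1 := by rwa [Real.exp_neg, mul_inv_le_iff₀ (Real.exp_pos 3), one_mul]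
  have hR := card_injOn_le_sum (b := b) hm J
  rw [← Fintype.sum_pow (fun c => if c ∈ J then lam else 1) b] at hR
  have : (16 : ℝ) * Nat.card {h : Fin b ⊕ Fin b → Fin m // Set.InjOn h (h ⁻¹' J)}
      ≤ (m : ℝ) ^ (2 * b) := by
    calc _ ≤ 16 * ((m : ℝ) ^ b * (m * Real.exp (-(3 / 8 * (b / m)))) ^ b) := by
          gcongr
          exact hR.trans (by gcongr)
      _ = (m : ℝ) ^ (2 * b) * (16 * Real.exp (-(3 / 8 * (b / m))) ^ b) := by
          rw [mul_pow]; ring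
      _ ≤ (m : ℝ) ^ (2 * b) * 1 := by gcongr
      _ = _ := mul_one _
  exact_mod_cast this

/-! ### Tables without collisions in a large minor -/

/-- A table of words `g i`, with letters in the same set as the indices `i`, is sparse if for some
sets `I` of words and `J` of letters, both of size at least `3 * r`, no word in `I` uses a letter
of `J` twice. -/
def IsSparseTable {ι κ : Type*} (r : ℕ) (g : ι → κ → ι) : Prop :=
  ∃ I J : Finset ι, 3 * r ≤ I.card ∧ 3 * r ≤ J.card ∧ ∀ i ∈ I, Set.InjOn (g i) (g i ⁻¹' J)

theorem pow_mul_card_forall_injOn_le {m b : ℕ} {I J : Finset (Fin m)} (hm : 0 < m) (hbm : b ≤ m)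
    (hJ : 3 * m ≤ 4 * J.card) (hb : 8 * m ≤ b ^ 2) :
    16 ^ I.card *
      Nat.card {g : Fin m → Fin b ⊕ Fin b → Fin m // ∀ i, i ∈ I → Set.InjOn (g i) (g i ⁻¹' J)}
      ≤ (m ^ (2 * b)) ^ m := by
  classical
  rw [Nat.card_congr (Equiv.subtypePiEquivPi (p := fun i (h : Fin b ⊕ Fin b → Fin m) =>
    i ∈ I → Set.InjOn h (h ⁻¹' J))), Nat.card_pi]
  have h1 : 16 ^ I.card = ∏ i : Fin m, if i ∈ I then 16 else 1 := by
    simp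
  have h2 : (m ^ (2 * b)) ^ m = ∏ _i : Fin m, m ^ (2 * b) := by simp
  rw [h1, h2, ← Finset.prod_mul_distrib]
  refine Finset.prod_le_prod' fun i _ => ?_
  by_cases hi : i ∈ I
  · simpa [hi] using sixteen_mul_card_injOn_le hm hbm hJ hb
  · simp [hi, two_mul]

/-- The union bound over the `2 ^ (4 * r) * 2 ^ (4 * r)` choices of the sets of words and of
letters. -/
theorem pow_mul_card_isSparseTable_le {r b : ℕ} (hr : 0 < r) (hbr : b ≤ 4 * r)
    (hb : 32 * r ≤ b ^ 2) :
    16 ^ r * Nat.card {g : Fin (4 * r) → Fin b ⊕ Fin b → Fin (4 * r) // IsSparseTable r g}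
      ≤ ((4 * r) ^ (2 * b)) ^ (4 * r) := by
  classical
  set m := 4 * r with hm
  set W := {p : Finset (Fin m) × Finset (Fin m) // 3 * r ≤ p.1.card ∧ 3 * r ≤ p.2.card}
  have hunion : Nat.card {g : Fin m → Fin b ⊕ Fin b → Fin m // IsSparseTable r g}
      ≤ ∑ p : W, Nat.card {g : Fin m → Fin b ⊕ Fin b → Fin m //
          ∀ i, i ∈ p.1.1 → Set.InjOn (g i) (g i ⁻¹' p.1.2)} := by
    rw [← Nat.card_sigma]
    choose I J hI hJ h using fun g :
      {g : Fin m → Fin b ⊕ Fin b → Fin m // IsSparseTable r g} => g.2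
    refine Nat.card_le_card_of_injective
      (fun g => ⟨⟨(I g, J g), hI g, hJ g⟩, ⟨g.1, h g⟩⟩) fun g g' e => Subtype.ext ?_
    exact congrArg (fun x => x.2.1) e
  have hW : Fintype.card W ≤ 16 ^ (2 * r) := by
    refine (Fintype.card_subtype_le _).trans_eq ?_
    rw [Fintype.card_prod, Fintype.card_finset, Fintype.card_fin, ← pow_add, hm,
      show (16 : ℕ) = 2 ^ 4 by norm_num, ← pow_mul]
    congr 1; ring
  have hterm : ∀ p : W, 16 ^ (3 * r) * Nat.card {g : Fin m → Fin b ⊕ Fin b → Fin m //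
      ∀ i, i ∈ p.1.1 → Set.InjOn (g i) (g i ⁻¹' p.1.2)} ≤ (m ^ (2 * b)) ^ m := fun p =>
    (Nat.mul_le_mul_right _ (Nat.pow_le_pow_right (by norm_num) p.2.1)).trans
      (pow_mul_card_forall_injOn_le (by omega) hbr (by have := p.2.2; omega) (by omega))
  have h3 : 16 ^ (2 * r) * (16 ^ r *
      Nat.card {g : Fin m → Fin b ⊕ Fin b → Fin m // IsSparseTable r g})
      ≤ 16 ^ (2 * r) * (m ^ (2 * b)) ^ m := by
    calc _ = 16 ^ (3 * r) *
          Nat.card {g : Fin m → Fin b ⊕ Fin b → Fin m // IsSparseTable r g} := by ring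
      _ ≤ 16 ^ (3 * r) * _ := Nat.mul_le_mul_left _ hunion
      _ ≤ ∑ _p : W, (m ^ (2 * b)) ^ m := by
          rw [Finset.mul_sum]
          exact Finset.sum_le_sum fun p _ => hterm p
      _ = Fintype.card W * (m ^ (2 * b)) ^ m := by simp
      _ ≤ _ := Nat.mul_le_mul_right _ hW
  exact Nat.le_of_mul_le_mul_left h3 (by positivity)

/-! ### Twins from a matching of cells -/

/-- Either a bipartite relation contains a matching of size `r`, or the pairs that miss a maximal
matching are all unrelated. -/
theorem exists_matching_or_exists_unrelated {ι : Type*} [Fintype ι] (G : ι → ι → Prop) (r : ℕ) :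
    (∃ (A : Finset ι) (φ : ι → ι), r ≤ A.card ∧ Set.InjOn φ A ∧ ∀ i ∈ A, G i (φ i)) ∨
      ∃ I J : Finset ι, Fintype.card ι ≤ I.card + r ∧ Fintype.card ι ≤ J.card + r ∧
        ∀ i ∈ I, ∀ j ∈ J, ¬ G i j := by
  classical
  let 𝒜 : Finset (Finset ι) :=
    Finset.univ.filter fun A => ∃ φ : ι → ι, Set.InjOn φ A ∧ ∀ i ∈ A, G i (φ i)
  obtain ⟨A, hA, hmax⟩ := 𝒜.exists_max_image Finset.card
    ⟨∅, Finset.mem_filter.2 ⟨Finset.mem_univ _, id, by simp, by simp⟩⟩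
  obtain ⟨φ, hφ, hG⟩ := (Finset.mem_filter.1 hA).2
  by_cases hr : r ≤ A.card
  · exact Or.inl ⟨A, φ, hr, hφ, hG⟩
  refine Or.inr ⟨Aᶜ, (A.image φ)ᶜ, ?_, ?_, fun i hi j hj hij => ?_⟩
  · have := A.card_add_card_compl; omega
  · have := (A.image φ).card_add_card_compl
    have := Finset.card_image_le (s := A) (f := φ)
    omega
  · rw [Finset.mem_compl] at hi hj
    have hne : ∀ a ∈ A, a ≠ i := fun a ha e => hi (e ▸ ha)
    have hup : ∀ a ∈ A, Function.update φ i j a = φ a := fun a ha =>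
      Function.update_of_ne (hne a ha) _ _
    have hmem : insert i A ∈ 𝒜 := by
      refine Finset.mem_filter.2 ⟨Finset.mem_univ _, Function.update φ i j, ?_, ?_⟩
      · rw [Finset.coe_insert, Set.injOn_insert (by simpa using hi)]
        refine ⟨fun a ha b hb => ?_, ?_⟩
        · rw [hup a ha, hup b hb]; exact fun e => hφ ha hb e
        · rintro ⟨a, ha, e⟩
          rw [hup a ha, Function.update_self] at e
          exact hj (Finset.mem_image.2 ⟨a, ha, e⟩)
      · intro a ha
        rcases Finset.mem_insert.1 ha with rfl | ha
        · rwa [Function.update_self]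
        · rw [hup a ha]; exact hG a ha
    have := hmax _ hmem
    rw [Finset.card_insert_of_notMem hi] at this
    omega

/-- The positions are arranged in rows by `e`, and the values in columns by the first coordinate of
`ψ`. If `π` has no twins of length `r`, then there are large sets of rows and columns whose common
cells contain at most one point each: a matching of `r` cells with two points in each would give
twins, one point of every cell going to either of them. -/
theorem isSparseTable_of_not_hasTwins {n r w : ℕ} {κ : Type*} {e : Fin (4 * r) × κ → Fin n}
    (he : Function.Injective e) (hrow : ∀ i i' p p', i < i' → e (i, p) < e (i', p'))
    {ψ : Fin n → Fin (4 * r) ×ₗ Fin w} (hψ : StrictMono ψ) {π : Equiv.Perm (Fin n)}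
    (hπ : ¬ HasTwins π r) :
    IsSparseTable r fun i p => (ofLex (ψ (π (e (i, p))))).1 := by
  rcases exists_matching_or_exists_unrelated (fun i j => ∃ p q, p ≠ q ∧
    (ofLex (ψ (π (e (i, p))))).1 = j ∧ (ofLex (ψ (π (e (i, q))))).1 = j) r with
    ⟨A, φ, hA, hφ, hG⟩ | ⟨I, J, hI, hJ, hIJ⟩
  · refine absurd ?_ hπ
    let a := A.orderEmbOfCardLe hA
    have ha : ∀ l, a l ∈ A := fun l => A.orderEmbOfCardLe_mem hA l
    choose p q hpq hp hq using fun l => hG (a l) (ha l)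
    have hlt : ∀ {x y : Fin n} {k l : Fin r}, (ofLex (ψ (π x))).1 = φ (a k) →
        (ofLex (ψ (π y))).1 = φ (a l) → k ≠ l → (π x < π y ↔ φ (a k) < φ (a l)) := by
      intro x y k l hx hy hkl
      have hne : φ (a k) ≠ φ (a l) := fun h => hkl (a.injective (hφ (ha k) (ha l) h))
      rw [← hψ.lt_iff_lt, Prod.Lex.lt_iff, hx, hy]
      simp [hne]
    refine ⟨OrderEmbedding.ofStrictMono (fun l => e (a l, p l))
        fun k l hkl => hrow _ _ _ _ (a.strictMono hkl),
      OrderEmbedding.ofStrictMono (fun l => e (a l, q l))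
        fun k l hkl => hrow _ _ _ _ (a.strictMono hkl), ?_, fun k l hkl => ?_⟩
    · rw [Set.disjoint_left]
      rintro _ ⟨k, rfl⟩ ⟨l, h⟩
      have h' := he h
      rw [Prod.mk.injEq] at h'
      have hkl : l = k := a.injective h'.1
      rw [hkl] at h'
      exact hpq k h'.2.symm
    · exact (hlt (hp k) (hp l) hkl.ne).trans
        (hlt (hq k) (hq l) hkl.ne).symm
  · rw [Fintype.card_fin] at hI hJ
    refine ⟨I, J, by omega, by omega, fun i hi p hp q _ hpq => ?_⟩
    by_contra hne
    exact hIJ i hi _ hp ⟨p, q, hne, rfl, hpq.symm⟩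

/-! ### From random permutations to random words -/

/-- Drawing a set of `n` values and arranging it in the order given by a random permutation is the
same as drawing an injective word. Only one direction of this correspondence is needed. -/
theorem card_perm_mul_choose_le {n : ℕ} {α : Type*} [LinearOrder α] [Fintype α]
    {P : Equiv.Perm (Fin n) → Prop} {Q : (Fin n → α) → Prop}
    (h : ∀ π, P π → ∀ ψ : Fin n → α, StrictMono ψ → Q (ψ ∘ π)) :
    Nat.card {π // P π} * (Fintype.card α).choose n ≤ Nat.card {f // Q f} := by
  classical
  rw [← Fintype.card_finset_len, ← Nat.card_eq_fintype_card, ← Nat.card_prod]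
  refine Nat.card_le_card_of_injective
    (fun x : {π // P π} × {S : Finset α // S.card = n} =>
      ⟨x.2.1.orderEmbOfFin x.2.2 ∘ x.1.1, h _ x.1.2 _ (OrderEmbedding.strictMono _)⟩) ?_
  rintro ⟨⟨π, hπ⟩, S, hS⟩ ⟨⟨π', hπ'⟩, S', hS'⟩ e
  have e' : S.orderEmbOfFin hS ∘ π = S'.orderEmbOfFin hS' ∘ π' := congrArg Subtype.val e
  have hSS : S = S' := by
    have := congrArg Set.range e'
    rwa [π.surjective.range_comp, π'.surjective.range_comp, Finset.range_orderEmbOfFin,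
      Finset.range_orderEmbOfFin, Finset.coe_inj] at this
  subst hSS
  have hππ : π = π' := Equiv.ext fun x => (S.orderEmbOfFin hS).injective (congrFun e' x)
  subst hππ
  rfl

/-- The number of words `f` subject to a condition on the first coordinates of the letters at the
positions in the range of `e`. -/
theorem card_words_le {n m w : ℕ} {ι κ : Type*} [Fintype ι] [Fintype κ] {e : ι × κ → Fin n}
    (he : Function.Injective e) (Q : (ι → κ → Fin m) → Prop) :
    Nat.card {f : Fin n → Fin m ×ₗ Fin w // Q fun i p => (ofLex (f (e (i, p)))).1}
      ≤ Nat.card {g // Q g} * w ^ (Fintype.card ι * Fintype.card κ)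
        * (m * w) ^ (n - Fintype.card ι * Fintype.card κ) := by
  classical
  have hcard := Nat.card_le_card_of_injective
    (fun f : {f : Fin n → Fin m ×ₗ Fin w // Q fun i p => (ofLex (f (e (i, p)))).1} =>
      (((⟨_, f.2⟩, fun x => (ofLex (f.1 (e x))).2), fun x => f.1 x.1) :
        ({g // Q g} × (ι × κ → Fin w)) × ({x // x ∉ Set.range e} → Fin m ×ₗ Fin w))) (by
      rintro ⟨f, hf⟩ ⟨f', hf'⟩ h
      simp only [Prod.mk.injEq, Subtype.mk.injEq] at h
      obtain ⟨⟨h1, h2⟩, h3⟩ := h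
      refine Subtype.ext (funext fun x => ?_)
      by_cases hx : x ∈ Set.range e
      · obtain ⟨⟨i, p⟩, rfl⟩ := hx
        exact ofLex.injective (Prod.ext (congrFun (congrFun h1 i) p) (congrFun h2 (i, p)))
      · exact congrFun h3 ⟨x, hx⟩)
  have hcompl : Nat.card {x // x ∉ Set.range e} = n - Fintype.card ι * Fintype.card κ := by
    rw [Nat.card_eq_fintype_card, Fintype.card_subtype_compl, Fintype.card_fin,
      ← Fintype.card_prod]
    congr 1
    exact Set.card_range_of_injective he
  have hlex : Nat.card (Fin m ×ₗ Fin w) = m * w := by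
    rw [Nat.card_congr ofLex, Nat.card_prod, Nat.card_fin, Nat.card_fin]
  rw [Nat.card_prod, Nat.card_prod, Nat.card_fun, Nat.card_fun, hcompl, hlex, Nat.card_fin,
    Nat.card_prod, Nat.card_eq_fintype_card (α := ι), Nat.card_eq_fintype_card (α := κ)] at hcard
  exact hcard

/-- A word of length `n` over `N ≥ 2 * n ^ 2` letters is injective with probability at least
`1 / 2`. -/
theorem pow_le_two_mul_factorial_mul_choose {n N : ℕ} (h : 2 * n ^ 2 ≤ N) :
    N ^ n ≤ 2 * (n.factorial * N.choose n) := by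
  rcases Nat.eq_zero_or_pos n with rfl | hn
  · simp
  rw [← Nat.descFactorial_eq_factorial_mul_choose]
  have hnN : n ≤ N := by nlinarith
  have hN : (0 : ℝ) < N := by exact_mod_cast (by omega : 0 < N)
  have h1 : ((N - n : ℕ) : ℝ) ^ n ≤ N.descFactorial n := by
    exact_mod_cast (Nat.pow_le_pow_left (by omega) n).trans (Nat.pow_sub_le_descFactorial N n)
  have h2 : (1 : ℝ) / 2 ≤ (1 - n / N) ^ n := by
    have h3 : -2 ≤ -((n : ℝ) / N) := by
      have : (n : ℝ) / N ≤ 1 := by rw [div_le_one hN]; exact_mod_cast hnN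
      linarith
    have h4 := one_add_mul_le_pow h3 n
    have h5 : (n : ℝ) * (n / N) ≤ 1 / 2 := by
      rw [mul_div_assoc', div_le_iff₀ hN]
      have : 2 * (n : ℝ) ^ 2 ≤ N := by exact_mod_cast h
      linarith
    rw [← sub_eq_add_neg] at h4
    linarith
  have h6 : (N : ℝ) ^ n ≤ 2 * N.descFactorial n := by
    calc (N : ℝ) ^ n = 2 * (N ^ n * (1 / 2)) := by ring
      _ ≤ 2 * ((N : ℝ) ^ n * (1 - n / N) ^ n) := by gcongr
      _ = 2 * ((N - n : ℕ) : ℝ) ^ n := by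
          rw [← mul_pow, Nat.cast_sub hnN]; congr 2; field_simp
      _ ≤ _ := by gcongr
  exact_mod_cast h6

/-- The partition of an initial segment of the positions into rows of length `2 * b`. -/
theorem exists_rows {n m b : ℕ} (h : m * (b + b) ≤ n) :
    ∃ e : Fin m × (Fin b ⊕ Fin b) → Fin n, Function.Injective e ∧
      ∀ i i' p p', i < i' → e (i, p) < e (i', p') := by
  refine ⟨fun x => Fin.castLE h (finProdFinEquiv (x.1, finSumFinEquiv x.2)), ?_, ?_⟩
  · rintro ⟨i, p⟩ ⟨i', p'⟩ hx
    simpa using hx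
  · intro i i' p p' hii
    rw [Fin.lt_def, Fin.val_castLE, Fin.val_castLE, finProdFinEquiv_apply_val,
      finProdFinEquiv_apply_val]
    have h1 := (finSumFinEquiv p).isLt
    have h2 : (b + b) * (i.1 + 1) ≤ (b + b) * i'.1 := Nat.mul_le_mul_left _ hii
    rw [Nat.mul_add] at h2
    dsimp only
    omega

/-- A random permutation has no twins of length `r` with probability at most `2 * 16 ^ (-r)`, if
the `4 * r` rows of length `2 * b` fit and are long enough. -/
theorem pow_mul_card_not_hasTwins_le {n r b : ℕ} (hr : 0 < r) (hbr : b ≤ 4 * r)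
    (hb : 32 * r ≤ b ^ 2) (hn : 8 * r * b ≤ n) :
    16 ^ r * Nat.card {π : Equiv.Perm (Fin n) // ¬ HasTwins π r} ≤ 2 * n.factorial := by
  have hn' : 4 * r * (b + b) ≤ n := by linarith
  obtain ⟨e, he, hrow⟩ := exists_rows hn'
  have hn0 : 0 < n := by
    have : 0 < b := Nat.pos_of_ne_zero fun h => by subst h; omega
    have : 0 < 8 * r * b := by positivity
    omega
  set w := 2 * n ^ 2
  have hw : 0 < w := by positivity
  have h1 := card_perm_mul_choose_le (P := fun π : Equiv.Perm (Fin n) => ¬ HasTwins π r)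
    (Q := fun f : Fin n → Fin (4 * r) ×ₗ Fin w =>
      IsSparseTable r fun i p => (ofLex (f (e (i, p)))).1)
    fun π hπ ψ hψ => isSparseTable_of_not_hasTwins he hrow hψ hπ
  have h2 := card_words_le (w := w) he (IsSparseTable r)
  have h3 := pow_mul_card_isSparseTable_le hr hbr hb
  have h4 : (4 * r * w) ^ n ≤ 2 * (n.factorial * (4 * r * w).choose n) :=
    pow_le_two_mul_factorial_mul_choose (Nat.le_mul_of_pos_left _ (by positivity))
  have hlex : Fintype.card (Fin (4 * r) ×ₗ Fin w) = 4 * r * w := by simp [Lex]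
  rw [hlex] at h1
  simp only [Fintype.card_fin, Fintype.card_sum] at h2
  set T := Nat.card {g : Fin (4 * r) → Fin b ⊕ Fin b → Fin (4 * r) // IsSparseTable r g}
  set B := Nat.card {π : Equiv.Perm (Fin n) // ¬ HasTwins π r}
  set K := (4 * r * w).choose n
  have hK : 0 < K := Nat.pos_of_ne_zero fun h => by
    rw [h] at h4
    have : 0 < (4 * r * w) ^ n := by positivity
    omega
  refine Nat.le_of_mul_le_mul_right ?_ hK
  calc 16 ^ r * B * K = 16 ^ r * (B * K) := by ring
    _ ≤ 16 ^ r * _ := Nat.mul_le_mul_left _ (h1.trans h2)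
    _ = (16 ^ r * T) * w ^ (4 * r * (b + b)) * (4 * r * w) ^ (n - 4 * r * (b + b)) := by
        simp only [mul_assoc]
    _ ≤ ((4 * r) ^ (2 * b)) ^ (4 * r) * w ^ (4 * r * (b + b))
          * (4 * r * w) ^ (n - 4 * r * (b + b)) := by gcongr
    _ = (4 * r * w) ^ (4 * r * (b + b)) * (4 * r * w) ^ (n - 4 * r * (b + b)) := by
        rw [← pow_mul, show 2 * b * (4 * r) = 4 * r * (b + b) by ring, ← mul_pow (4 * r) w]
    _ = (4 * r * w) ^ n := by rw [← pow_add, Nat.add_sub_cancel' hn']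
    _ ≤ 2 * n.factorial * K := by rwa [mul_assoc 2]

/-! ### The asymptotic statement -/

theorem randomPermLaw_setOf (n : ℕ) (P : Equiv.Perm (Fin n) → Prop) :
    randomPermLaw n {π | P π} = ENNReal.ofReal (Nat.card {π // P π} / n.factorial) := by
  classical
  rw [randomPermLaw, @PMF.toMeasure_uniformOfFintype_apply _ _ _ _ ⊤ trivial,
    ENNReal.ofReal_div_of_pos (by positivity), ENNReal.ofReal_natCast, ENNReal.ofReal_natCast,
    Fintype.card_perm, Fintype.card_fin, Nat.card_eq_fintype_card]
  rfl

theorem one_sub_le_card_div_factorial {n r k b : ℕ} {P : Equiv.Perm (Fin n) → Prop} (hr : 0 < r)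
    (hbr : b ≤ 4 * r) (hb : 32 * r ≤ b ^ 2) (hn : 8 * r * b ≤ n)
    (hk : (4 : ℝ) ^ 3 * (n : ℝ) ^ 2 ≤ (k : ℝ) ^ 3)
    (hP : ∀ π, HasTwins π r → ¬ HasTwins π k → P π) :
    1 - (2 * (1 / 16) ^ r + (1 / 2) ^ k) ≤ (Nat.card {π // P π} : ℝ) / n.factorial := by
  classical
  have hf : (0 : ℝ) < n.factorial := by positivity
  have h1 : (16 : ℝ) ^ r * Nat.card {π : Equiv.Perm (Fin n) // ¬ HasTwins π r}
      ≤ 2 * n.factorial := by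
    exact_mod_cast pow_mul_card_not_hasTwins_le hr hbr hb hn
  have h2 : (Nat.card {π : Equiv.Perm (Fin n) // ¬ HasTwins π r} : ℝ) / n.factorial
      ≤ 2 * (1 / 16) ^ r := by
    rw [div_le_iff₀ hf, one_div, inv_pow, mul_right_comm, ← div_eq_mul_inv,
      le_div_iff₀ (by positivity)]
    linarith
  have h3 := card_hasTwins_div_factorial_le hk
  have h4 : n.factorial ≤ Nat.card {π // P π} +
      (Nat.card {π : Equiv.Perm (Fin n) // ¬ HasTwins π r} +
        Nat.card {π : Equiv.Perm (Fin n) // HasTwins π k}) := by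
    have hall : ∀ π : Equiv.Perm (Fin n), P π ∨ (¬ HasTwins π r ∨ HasTwins π k) := fun π => by
      have := hP π
      tauto
    simp only [Nat.card_eq_fintype_card]
    calc n.factorial
        = Fintype.card {π : Equiv.Perm (Fin n) // P π ∨ (¬ HasTwins π r ∨ HasTwins π k)} := by
          rw [Fintype.card_congr (Equiv.subtypeUnivEquiv hall), Fintype.card_perm,
            Fintype.card_fin]
      _ ≤ _ := (Fintype.card_subtype_or _ _).trans
          (Nat.add_le_add_left (Fintype.card_subtype_or _ _) _)
  have h5 : (1 : ℝ) ≤ (Nat.card {π // P π} : ℝ) / n.factorial +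
      ((Nat.card {π : Equiv.Perm (Fin n) // ¬ HasTwins π r} : ℝ) / n.factorial +
        (Nat.card {π : Equiv.Perm (Fin n) // HasTwins π k} : ℝ) / n.factorial) := by
    rw [← add_div, ← add_div, le_div_iff₀ hf, one_mul]
    exact_mod_cast h4
  linarith

/-- For `r` about `n ^ (2 / 3) / 32` there is a row length that makes collisions within a row
likely. -/
theorem exists_row_length {n r : ℕ} {x : ℝ} (hx : 16384 ≤ x) (hxn : x ^ 3 = (n : ℝ) ^ 2)
    (h1 : x / 64 ≤ r) (h2 : r ≤ x / 32) : ∃ b, b ≤ 4 * r ∧ 32 * r ≤ b ^ 2 ∧ 8 * r * b ≤ n := by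
  have hr0 : (0 : ℝ) < r := by linarith
  have hn0 : (0 : ℝ) ≤ n := by positivity
  have hxn' : x ≤ n := by
    by_contra! h
    nlinarith [pow_le_pow_left₀ hn0 h.le 2]
  have hnx : (n : ℝ) ≤ x ^ 2 / 128 := by
    refine le_of_sq_le_sq ?_ (by positivity)
    rw [← hxn]
    nlinarith [pow_pos (by linarith : 0 < x) 3]
  -- The largest `b` for which `4 * r` rows of length `2 * b` fit into `n` positions.
  refine ⟨n / (8 * r), ?_, ?_, Nat.mul_div_le _ _⟩
  · refine Nat.div_le_of_le_mul ?_
    have : (n : ℝ) ≤ 8 * r * (4 * r) := by nlinarith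
    exact_mod_cast this
  · have hb : (n : ℝ) ≤ 16 * r * (n / (8 * r) : ℕ) := by
      have h3 : n < 8 * r * (n / (8 * r) + 1) := by
        have hr1 : 0 < r := by exact_mod_cast hr0
        exact Nat.lt_mul_div_succ n (by positivity)
      have h4 : (n : ℝ) < 8 * r * ((n / (8 * r) : ℕ) + 1) := by exact_mod_cast h3
      linarith
    have h5 : (n : ℝ) ^ 2 ≤ (16 * r * (n / (8 * r) : ℕ)) ^ 2 := by gcongr
    have h6 : (r : ℝ) ^ 3 ≤ (n : ℝ) ^ 2 / 32768 := by
      calc (r : ℝ) ^ 3 ≤ (x / 32) ^ 3 := by gcongr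
        _ = _ := by rw [div_pow, hxn]; norm_num
    have h7 : (256 * (r : ℝ) ^ 2) * (32 * r) ≤ (256 * (r : ℝ) ^ 2) * (n / (8 * r) : ℕ) ^ 2 := by
      nlinarith
    exact_mod_cast le_of_mul_le_mul_left h7 (by positivity)

theorem theorem2p2 :
    ∃ c C : ℝ, 0 < c ∧ 0 < C ∧
      Tendsto
        (fun n : ℕ => randomPermLaw n
          {π : Equiv.Perm (Fin n) |
            c * ((n : ℝ) ^ (2 / 3 : ℝ) / Real.log n ^ (1 / 3 : ℝ)) ≤ (twinLength π : ℝ) ∧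
              (twinLength π : ℝ) ≤ C * (n : ℝ) ^ (2 / 3 : ℝ)})
        atTop (𝓝 1) := by
  refine ⟨1 / 64, 4, by norm_num, by norm_num, ?_⟩
  simp only [randomPermLaw_setOf]
  rw [← ENNReal.ofReal_one]
  refine ENNReal.tendsto_ofReal ?_
  have hx : Tendsto (fun n : ℕ => (n : ℝ) ^ (2 / 3 : ℝ)) atTop atTop :=
    (tendsto_rpow_atTop (by norm_num)).comp tendsto_natCast_atTop_atTop
  have hr : Tendsto (fun n : ℕ => ⌊(n : ℝ) ^ (2 / 3 : ℝ) / 32⌋₊) atTop atTop :=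
    tendsto_nat_floor_atTop.comp (hx.atTop_div_const (by norm_num))
  have hk : Tendsto (fun n : ℕ => ⌊4 * (n : ℝ) ^ (2 / 3 : ℝ)⌋₊ + 1) atTop atTop :=
    (tendsto_add_atTop_nat 1).comp
      (tendsto_nat_floor_atTop.comp (hx.const_mul_atTop four_pos))
  have hlim : Tendsto (fun n : ℕ => 1 - (2 * (1 / 16 : ℝ) ^ ⌊(n : ℝ) ^ (2 / 3 : ℝ) / 32⌋₊
      + (1 / 2) ^ (⌊4 * (n : ℝ) ^ (2 / 3 : ℝ)⌋₊ + 1))) atTop (𝓝 1) := by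
    have h1 := (tendsto_pow_atTop_nhds_zero_of_lt_one (r := (1 / 16 : ℝ)) (by norm_num)
      (by norm_num)).comp hr
    have h2 := (tendsto_pow_atTop_nhds_zero_of_lt_one (r := (1 / 2 : ℝ)) (by norm_num)
      (by norm_num)).comp hk
    simpa using ((h1.const_mul 2).add h2).const_sub 1
  refine tendsto_of_tendsto_of_tendsto_of_le_of_le' hlim tendsto_const_nhds ?_ ?_
  · filter_upwards [hx.eventually_ge_atTop 16384, eventually_ge_atTop 3] with n hxn hn3
    set x := (n : ℝ) ^ (2 / 3 : ℝ) with hxdef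
    have hx3 : x ^ 3 = (n : ℝ) ^ 2 := by
      rw [hxdef, ← Real.rpow_natCast, ← Real.rpow_mul (Nat.cast_nonneg n),
        ← Real.rpow_natCast (n : ℝ) 2]
      norm_num
    have hr2 : (⌊x / 32⌋₊ : ℝ) ≤ x / 32 := Nat.floor_le (by positivity)
    have hr1 : x / 64 ≤ ⌊x / 32⌋₊ := by linarith [Nat.lt_floor_add_one (x / 32)]
    have hk1 : 4 * x ≤ (⌊4 * x⌋₊ + 1 : ℕ) := by
      exact_mod_cast (Nat.lt_floor_add_one (4 * x)).le
    obtain ⟨b, hb1, hb2, hb3⟩ := exists_row_length hxn hx3 hr1 hr2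
    have hr0 : 0 < ⌊x / 32⌋₊ := by
      have : (0 : ℝ) < ⌊x / 32⌋₊ := by linarith
      exact_mod_cast this
    refine one_sub_le_card_div_factorial hr0 hb1 hb2 hb3 ?_ fun π ht ht' => ⟨?_, ?_⟩
    · rw [← hx3, ← mul_pow]
      gcongr
    · have h1 : (⌊x / 32⌋₊ : ℝ) ≤ twinLength π := by exact_mod_cast le_twinLength_iff.2 ht
      -- The logarithm only weakens the bound once `n ≥ 3`, where `log n ≥ 1`.
      have h2 : 1 ≤ Real.log n ^ (1 / 3 : ℝ) := by
        refine Real.one_le_rpow ?_ (by norm_num)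
        rw [Real.le_log_iff_exp_le (by positivity)]
        exact Real.exp_one_lt_three.le.trans (by exact_mod_cast hn3)
      have h3 : x / Real.log n ^ (1 / 3 : ℝ) ≤ x := div_le_self (by positivity) h2
      linarith
    · have h1 : twinLength π < ⌊4 * x⌋₊ + 1 := by
        rwa [← not_le, le_twinLength_iff]
      exact (Nat.le_floor_iff (by positivity)).1 (Nat.lt_succ_iff.1 h1)
  · refine Eventually.of_forall fun n => ?_
    rw [div_le_one (by positivity)]
    have := Finite.card_subtype_le fun π : Equiv.Perm (Fin n) =>
      1 / 64 * ((n : ℝ) ^ (2 / 3 : ℝ) / Real.log n ^ (1 / 3 : ℝ)) ≤ (twinLength π : ℝ) ∧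
        (twinLength π : ℝ) ≤ 4 * (n : ℝ) ^ (2 / 3 : ℝ)
    rw [Nat.card_perm, Nat.card_fin] at this
    exact_mod_cast this
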